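/- Let $K$ be a field of characteristic $0$ (for instance $K=\mathbb{C}$). Let $\mathfrak{g}$ be the Lie algebra over $K$ on three generators $x_1,x_2,x_3$ subject to the following relations, for all $i,j,k\in\{1,2,3\}$ (not necessarily distinct): 1. $[x_i,[x_j,[x_i,x_k]]] = 2\epsilon_{ijk}\,x_i$, 2. $[x_i,[x_i,[x_j,x_k]]] = 4\epsilon_{ijk}\,x_i$, 3. $[x_i,[x_j,[x_j,x_k]]] = 6\epsilon_{ijk}\,x_j$, that is, the quotient of the free Lie algebra on $x_1,x_2,x_3$ by the ideal generated by the differences of the two sides. Here $\epsilon_{ijk}$ is the Levi-Civita symbol: $1$ if $(i,j,k)$ is an even permutation of $(1,2,3)$, $-1$ if it is an odd permutation, and $0$ otherwise. Then $\mathfrak{g}$ is isomorphic, as a Lie algebra over $K$, to the (split) exceptional Lie algebra $\mathfrak{g}_2$, i.e. the Lie algebra given by Chevalley generators and Serre relations for the Cartan matrix of type $G_2$. Moreover $\dim_K\mathfrak{g}=14$, and $\mathfrak{g}$ is simple. More explicitly, in $\mathfrak{g}$ put $$y_1=\tfrac12[x_2,x_3],\quad y_2=\tfrac12[x_3,x_1],\quad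 y_3=\tfrac12[x_1,x_2],\qquad a_{ij}=\tfrac13[x_j,y_i]\ (i\neq j),$$ $$h_1=\tfrac13([x_1,y_1]-[x_2,y_2]),\qquad h_2=\tfrac13([x_2,y_2]-[x_3,y_3]).$$ The 14 elements $h_1,h_2,a_{12},a_{13},a_{23},a_{21},a_{31},a_{32},x_1,x_2,x_3,y_1,y_2,y_3$ form a basis of $\mathfrak{g}$, and their brackets are given by the following table. The entry in row $u$ and column $v$ is $[u,v]$; entries below the diagonal follow by antisymmetry. $$\begin{array}{c|cccccccccccccc} & h_1 & h_2 & a_{12} & a_{13} & a_{23} & a_{21} & a_{31} & a_{32} & x_1 & x_2 & x_3 & y_1 & y_2 & y_3\\ \hline h_1 & 0&0&2a_{12}&a_{13}&-a_{23}&-2a_{21}&-a_{31}&a_{32}&-x_1&x_2&0&y_1&-y_2&0\\ h_2 & &0&-a_{12}&a_{13}&2a_{23}&a_{21}&-a_{31}&-2a_{32}&0&-x_2&x_3&0&y_2&-y_3\\ a_{12} & & &0&0&a_{13}&h_1&-a_{32}&0&-x_2&0&0&0&y_1&0\\ a_{13} & & & &0&0&-a_{23}&h_1+h_2&a_{12}&-x_3&0&0&0&0&y_1\\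 a_{23} & & & & &0&0&a_{21}&h_2&0&-x_3&0&0&0&y_2\\ a_{21} & & & & & &0&0&-a_{31}&0&-x_1&0&y_2&0&0\\ a_{31} & & & & & & &0&0&0&0&-x_1&y_3&0&0\\ a_{32} & & & & & & & &0&0&0&-x_2&0&y_3&0\\ x_1 & & & & & & & & &0&2y_3&-2y_2&2h_1+h_2&3a_{21}&3a_{31}\\ x_2 & & & & & & & & & &0&2y_1&3a_{12}&-h_1+h_2&3a_{32}\\ x_3 & & & & & & & & & & &0&3a_{13}&3a_{23}&-h_1-2h_2\\ y_1 & & & & & & & & & & & &0&2x_3&-2x_2\\ y_2 & & & & & & & & & & & & &0&2x_1\\ y_3 & & & & & & & & & & & & & &0 \end{array}$$ Finally, there is an injective Lie algebra homomorphism $\varphi:\mathfrak{sl}(3,K)\to\mathfrak{g}$ with $\varphi(A)=A_{11}h_1-A_{33}h_2+\sum_{i\neq j}A_{ij}a_{ij}$ (so that $e_{ij}\mapsto a_{ij}$ for $i\ne j$ and $e_{ii}-e_{i+1,i+1}\mapsto h_i$ for $i=1,2$), and for all $A\in\mathfrak{sl}(3,K)$ and $k\in\{1,2,3\}$ $$[\varphi(A),x_k]=-\sum_{j}A_{kj}\,x_j,\qquad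 [\varphi(A),y_k]=\sum_i A_{ik}\,y_i .$$ -/

import Mathlib

namespace G2Quadruple

/-- The Levi-Civita symbol on three indices (indices `0, 1, 2` stand for `1, 2, 3`): `1` on the
even permutations of `(0, 1, 2)`, `-1` on the odd ones, `0` otherwise. -/
def leviCivita (i j k : Fin 3) : ℤ :=
  if (i, j, k) = (0, 1, 2) ∨ (i, j, k) = (1, 2, 0) ∨ (i, j, k) = (2, 0, 1) then 1
  else if (i, j, k) = (0, 2, 1) ∨ (i, j, k) = (2, 1, 0) ∨ (i, j, k) = (1, 0, 2) then -1
  else 0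

noncomputable section

universe u

/-- The generators of the free Lie algebra on three letters. -/
abbrev freeGen (K : Type u) [Field K] (i : Fin 3) : FreeLieAlgebra K (Fin 3) :=
  FreeLieAlgebra.of K i

/-- First family: `[x_i,[x_j,[x_i,x_k]]] - 2 ε_{ijk} x_i`. -/
def rel1 (K : Type u) [Field K] (i j k : Fin 3) : FreeLieAlgebra K (Fin 3) :=
  ⁅freeGen K i, ⁅freeGen K j, ⁅freeGen K i, freeGen K k⁆⁆⁆ - (2 * leviCivita i j k) • freeGen K i

/-- Second family: `[x_i,[x_i,[x_j,x_k]]] - 4 ε_{ijk} x_i`. -/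
def rel2 (K : Type u) [Field K] (i j k : Fin 3) : FreeLieAlgebra K (Fin 3) :=
  ⁅freeGen K i, ⁅freeGen K i, ⁅freeGen K j, freeGen K k⁆⁆⁆ - (4 * leviCivita i j k) • freeGen K i

/-- Third family: `[x_i,[x_j,[x_j,x_k]]] - 6 ε_{ijk} x_j`. -/
def rel3 (K : Type u) [Field K] (i j k : Fin 3) : FreeLieAlgebra K (Fin 3) :=
  ⁅freeGen K i, ⁅freeGen K j, ⁅freeGen K j, freeGen K k⁆⁆⁆ - (6 * leviCivita i j k) • freeGen K j

/-- All quadruple relators, for all `i, j, k` (not necessarily distinct). -/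
def relators (K : Type u) [Field K] : Set (FreeLieAlgebra K (Fin 3)) :=
  {r | ∃ i j k : Fin 3, r = rel1 K i j k ∨ r = rel2 K i j k ∨ r = rel3 K i j k}

/-- The ideal of the free Lie algebra generated by the quadruple relators. -/
def relIdeal (K : Type u) [Field K] : LieIdeal K (FreeLieAlgebra K (Fin 3)) :=
  LieSubmodule.lieSpan K (FreeLieAlgebra K (Fin 3)) (relators K)

/-- The Lie algebra on three generators subject to the quadruple relations. -/
abbrev QuadAlg (K : Type u) [Field K] : Type u :=
  FreeLieAlgebra K (Fin 3) ⧸ relIdeal K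

/-- The generators `x_1, x_2, x_3` of the quotient. -/
def x (K : Type u) [Field K] (i : Fin 3) : QuadAlg K :=
  LieSubmodule.Quotient.mk (freeGen K i)

/-- `y_1 = [x_2,x_3]/2`, `y_2 = [x_3,x_1]/2`, `y_3 = [x_1,x_2]/2` (indices are cyclic mod 3). -/
def y (K : Type u) [Field K] (i : Fin 3) : QuadAlg K :=
  (2⁻¹ : K) • ⁅x K (i + 1), x K (i + 2)⁆

/-- `a_{ij} = [x_j,y_i]/3`, used only for `i ≠ j`. -/
def a (K : Type u) [Field K] (i j : Fin 3) : QuadAlg K :=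
  (3⁻¹ : K) • ⁅x K j, y K i⁆

/-- `h_1 = ([x_1,y_1] - [x_2,y_2])/3`. -/
def h₁ (K : Type u) [Field K] : QuadAlg K :=
  (3⁻¹ : K) • (⁅x K 0, y K 0⁆ - ⁅x K 1, y K 1⁆)

/-- `h_2 = ([x_2,y_2] - [x_3,y_3])/3`. -/
def h₂ (K : Type u) [Field K] : QuadAlg K :=
  (3⁻¹ : K) • (⁅x K 1, y K 1⁆ - ⁅x K 2, y K 2⁆)

/-- The fourteen elements
`h_1, h_2, a_12, a_13, a_23, a_21, a_31, a_32, x_1, x_2, x_3, y_1, y_2, y_3`, in this order. -/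
def elt (K : Type u) [Field K] : Fin 14 → QuadAlg K :=
  ![h₁ K, h₂ K, a K 0 1, a K 0 2, a K 1 2, a K 1 0, a K 2 0, a K 2 1,
    x K 0, x K 1, x K 2, y K 0, y K 1, y K 2]

/-- The bracket table of `v = (h_1, h_2, a_12, a_13, a_23, a_21, a_31, a_32, x_1, …, y_3)`: row `p`
lists the values of `[v_p, v_q]` for `q = p, p + 1, …, 13`; the entries with `q < p`, which are
determined by antisymmetry, are not used and are filled with `0`. -/
def bracketTable {L : Type u} [AddCommGroup L] (v : Fin 14 → L) : Fin 14 → Fin 14 → L :=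
  let h1 := v 0; let h2 := v 1
  let a12 := v 2; let a13 := v 3; let a23 := v 4
  let a21 := v 5; let a31 := v 6; let a32 := v 7
  let x1 := v 8; let x2 := v 9; let x3 := v 10
  let y1 := v 11; let y2 := v 12; let y3 := v 13
  ![![0, 0, 2 • a12, a13, -a23, -(2 • a21), -a31, a32, -x1, x2, 0, y1, -y2, 0],
    ![0, 0, -a12, a13, 2 • a23, a21, -a31, -(2 • a32), 0, -x2, x3, 0, y2, -y3],
    ![0, 0, 0, 0, a13, h1, -a32, 0, -x2, 0, 0, 0, y1, 0],
    ![0, 0, 0, 0, 0, -a23, h1 + h2, a12, -x3, 0, 0, 0, 0, y1],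
    ![0, 0, 0, 0, 0, 0, a21, h2, 0, -x3, 0, 0, 0, y2],
    ![0, 0, 0, 0, 0, 0, 0, -a31, 0, -x1, 0, y2, 0, 0],
    ![0, 0, 0, 0, 0, 0, 0, 0, 0, 0, -x1, y3, 0, 0],
    ![0, 0, 0, 0, 0, 0, 0, 0, 0, 0, -x2, 0, y3, 0],
    ![0, 0, 0, 0, 0, 0, 0, 0, 0, 2 • y3, -(2 • y2), 2 • h1 + h2, 3 • a21, 3 • a31],
    ![0, 0, 0, 0, 0, 0, 0, 0, 0, 0, 2 • y1, 3 • a12, -h1 + h2, 3 • a32],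
    ![0, 0, 0, 0, 0, 0, 0, 0, 0, 0, 0, 3 • a13, 3 • a23, -h1 - 2 • h2],
    ![0, 0, 0, 0, 0, 0, 0, 0, 0, 0, 0, 0, 2 • x3, -(2 • x2)],
    ![0, 0, 0, 0, 0, 0, 0, 0, 0, 0, 0, 0, 0, 2 • x1],
    ![0, 0, 0, 0, 0, 0, 0, 0, 0, 0, 0, 0, 0, 0]]

end

end G2Quadruple

/-!
Write `y` for the halved brackets of the `x`'s. The three families of relations together say
exactly that, for all `p q r s`,

`⁅x p, ⁅x q, ⁅x r, x s⁆⁆⁆ = 6 ε_{prs} x q - 2 ε_{qrs} x p`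

(`isQuadTriple_iff`; among four indices in `{1, 2, 3}` two coincide, so no such bracket is left
undetermined). In terms of the mixed brackets `T i j = ⁅x j, y i⁆` this reads
`⁅x k, T i j⁆ = 3 δ_{ik} x j - δ_{ij} x k`: up to the factor 3 the `T i j` act on the `x`'s as the
trace-free parts of the matrix units act on the dual of `K³`. By the Leibniz rule they act on the
`y`'s as on `K³`, they satisfy the commutation relations of `sl(3)` among themselves, and
`Σ T i i = 0`. All brackets of the fourteen elements follow, hence also the bracket table, the
fact that the fourteen elements span, and the homomorphism from `sl(3)`, which is
`A ↦ 1/3 Σ A i j • T i j`.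

The fourteen elements are linearly independent because the relations hold for explicit
operators on the seven-dimensional space `K × K³ × K³` (the imaginary split octonions), written
with dot and cross products; see `isQuadTriple_repX` and `linearIndependent_elt`.

For simplicity of the algebra, the square of `ad (T i j)` with `i ≠ j` sends every element to a
multiple of `T i j`, the multiple being its coefficient at `T j i`, up to a nonzero factor. A
nonzero element of an ideal can be moved, by a bracket with some `x k` or `y k`, to one with a
nonzero coefficient of this kind, unless it is diagonal; a diagonal element scales some `x k` by a
nonzero factor. In every case the ideal contains the generators (`eq_zero_of_mem`).

For the isomorphism with `g₂`, any Lie algebra generated by elements satisfying the Serre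
relations of type `G₂` is spanned by the two Cartan elements and twelve iterated brackets
(`IsG2System.span_rootElt`); the negative half is reduced to the positive one by the symmetry
`(e, f, h) ↦ (f, e, -h)`. The elements `y 2, a 1 2` and `-x 2, a 2 1` (indices from `1` to `3`)
satisfy these relations, so there is a surjection from `g₂`, of dimension at most `14`, onto the
given algebra, of dimension `14`.
-/

namespace G2Quadruple

universe u

/-! ### Quotients of free Lie algebras -/

section FreeQuotient
variable {K : Type*} [CommRing K] {X : Type*} {I : LieIdeal K (FreeLieAlgebra K X)}
  {L : Type*} [LieRing L] [LieAlgebra K L]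

/-- A quotient of a free Lie algebra is generated by the images of the free generators. -/
theorem eq_top_of_mk_of_mem (S : LieSubalgebra K (FreeLieAlgebra K X ⧸ I))
    (h : ∀ i, (LieSubmodule.Quotient.mk (FreeLieAlgebra.of K i) : FreeLieAlgebra K X ⧸ I) ∈ S) :
    S = ⊤ := by
  let π : FreeLieAlgebra K X →ₗ⁅K⁆ FreeLieAlgebra K X ⧸ I :=
    { LieSubmodule.Quotient.mk' I with map_lie' := rfl }
  let f : FreeLieAlgebra K X →ₗ⁅K⁆ S := FreeLieAlgebra.lift K fun i ↦ ⟨_, h i⟩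
  have hf : S.incl.comp f = π := by
    ext i; simp [f]; rfl
  refine eq_top_iff.2 fun v _ ↦ ?_
  obtain ⟨u, rfl⟩ := LieSubmodule.Quotient.surjective_mk' I v
  exact (LieHom.congr_fun hf u) ▸ (f u).2

/-- The universal property of a Lie algebra given by generators and relations. -/
theorem exists_lieHom_mk_of_eq (g : X → L) (hg : I ≤ (FreeLieAlgebra.lift K g).ker) :
    ∃ F : (FreeLieAlgebra K X ⧸ I) →ₗ⁅K⁆ L,
      ∀ i, F (LieSubmodule.Quotient.mk (FreeLieAlgebra.of K i)) = g i := by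
  refine ⟨{ I.toSubmodule.liftQ (FreeLieAlgebra.lift K g : FreeLieAlgebra K X →ₗ[K] L) hg with
    map_lie' := ?_ }, FreeLieAlgebra.lift_of_apply g⟩
  rintro ⟨u⟩ ⟨v⟩
  exact (FreeLieAlgebra.lift K g).map_lie u v

end FreeQuotient

/-! ### The quadruple relations in one formula -/

section
variable {K : Type*} [Field K] {L : Type*} [LieRing L] [LieAlgebra K L]

/-- The quadruple relations for three elements of a Lie algebra, in the uniform shape that
determines all brackets `⁅x p, ⁅x q, ⁅x r, x s⁆⁆⁆`. -/
def IsQuadTriple (x : Fin 3 → L) : Prop :=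
  ∀ p q r s, ⁅x p, ⁅x q, ⁅x r, x s⁆⁆⁆ =
    (6 * leviCivita p r s) • x q - (2 * leviCivita q r s) • x p

theorem leviCivita_succ (i j : Fin 3) :
    leviCivita j (i + 1) (i + 2) = if i = j then 1 else 0 := by
  revert i j; decide

/-- The uniform relation is equivalent to the three families of quadruple relations: for `r ≠ s` the
indices `p, q, r, s` always have a coincidence that one of the families covers, possibly after
exchanging `r` and `s`. -/
theorem isQuadTriple_iff (x : Fin 3 → L) : IsQuadTriple x ↔ ∀ i j k,
    ⁅x i, ⁅x j, ⁅x i, x k⁆⁆⁆ = (2 * leviCivita i j k) • x i ∧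
    ⁅x i, ⁅x i, ⁅x j, x k⁆⁆⁆ = (4 * leviCivita i j k) • x i ∧
    ⁅x i, ⁅x j, ⁅x j, x k⁆⁆⁆ = (6 * leviCivita i j k) • x j := by
  constructor
  · intro h i j k
    refine ⟨?_, ?_, ?_⟩ <;> rw [h] <;> fin_cases i <;> fin_cases j <;> fin_cases k <;>
      simp [leviCivita] <;> module
  · intro h p q r s
    by_cases hrs : r = s
    · subst hrs
      have (i j : Fin 3) : leviCivita i j j = 0 := by revert i j; decide
      simp [this]
    have key : p = q ∨ p = r ∨ p = s ∨ q = r ∨ q = s := by omega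
    have hsk : ⁅x p, ⁅x q, ⁅x r, x s⁆⁆⁆ = -⁅x p, ⁅x q, ⁅x s, x r⁆⁆⁆ := by
      rw [← lie_skew (x r) (x s), lie_neg, lie_neg]
    obtain rfl | rfl | rfl | rfl | rfl := key
    · rw [(h p r s).2.1]; module
    · rw [(h p q s).1]
      clear h hsk hrs; fin_cases p <;> fin_cases q <;> fin_cases s <;> simp [leviCivita]
    · rw [hsk, (h p q r).1]
      clear h hsk hrs; fin_cases p <;> fin_cases q <;> fin_cases r <;> simp [leviCivita]
    · rw [(h p q s).2.2]
      clear h hsk hrs; fin_cases p <;> fin_cases q <;> fin_cases s <;> simp [leviCivita]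
    · rw [hsk, (h p q r).2.2]
      clear h hsk hrs; fin_cases p <;> fin_cases q <;> fin_cases r <;> simp [leviCivita]

theorem x_isQuadTriple (K : Type*) [Field K] : IsQuadTriple (x K) := by
  have key (r : FreeLieAlgebra K (Fin 3)) (hr : r ∈ relators K) :
      (LieSubmodule.Quotient.mk r : QuadAlg K) = 0 :=
    LieSubmodule.Quotient.mk_eq_zero'.2 (LieSubmodule.subset_lieSpan hr)
  rw [isQuadTriple_iff]
  refine fun i j k ↦ ⟨sub_eq_zero.1 (key (rel1 K i j k) ⟨i, j, k, .inl rfl⟩),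
    sub_eq_zero.1 (key (rel2 K i j k) ⟨i, j, k, .inr (.inl rfl)⟩),
    sub_eq_zero.1 (key (rel3 K i j k) ⟨i, j, k, .inr (.inr rfl)⟩)⟩

/-- The universal property of `QuadAlg K`. -/
theorem exists_lieHom {x' : Fin 3 → L} (h : IsQuadTriple x') :
    ∃ f : QuadAlg K →ₗ⁅K⁆ L, ∀ i, f (x K i) = x' i := by
  refine exists_lieHom_mk_of_eq x' ?_
  rw [relIdeal, LieSubmodule.lieSpan_le]
  rintro _ ⟨i, j, k, rfl | rfl | rfl⟩
  · simpa [rel1, sub_eq_zero] using ((isQuadTriple_iff x').1 h i j k).1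
  · simpa [rel2, sub_eq_zero] using ((isQuadTriple_iff x').1 h i j k).2.1
  · simpa [rel3, sub_eq_zero] using ((isQuadTriple_iff x').1 h i j k).2.2

end

/-! ### Brackets of quadruple generators -/

section
variable {K : Type*} [Field K] {L : Type*} [LieRing L] [LieAlgebra K L]

variable (K) in
/-- The elements `y i`, halved brackets of the two other generators in cyclic order. -/
def dual (x : Fin 3 → L) (i : Fin 3) : L := (2⁻¹ : K) • ⁅x (i + 1), x (i + 2)⁆

variable (K) in
/-- The mixed brackets `⁅x j, y i⁆`. Up to the factor `3` they play the role of the trace-free parts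
of the matrix units `e_{ij}`. -/
def mixed (x : Fin 3 → L) (i j : Fin 3) : L := ⁅x j, dual K x i⁆

section
variable [CharZero K] {x : Fin 3 → L}

variable (K) in
theorem lie_succ (x : Fin 3 → L) (i : Fin 3) : ⁅x i, x (i + 1)⁆ = (2 : K) • dual K x (i + 2) := by
  have h1 : i + 2 + 1 = i := by omega
  have h2 : i + 2 + 2 = i + 1 := by omega
  rw [dual, h1, h2, smul_smul]; norm_num

/-- The quadruple relations, read as the action of the mixed brackets on the generators. All other
brackets follow from this formula by the Leibniz rule. -/
theorem lie_mixed (hx : IsQuadTriple x) (i j k : Fin 3) : ⁅x k, mixed K x i j⁆ =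
    (if i = k then (3 : K) else 0) • x j - (if i = j then (1 : K) else 0) • x k := by
  rw [mixed, dual, lie_smul, lie_smul, hx, leviCivita_succ, leviCivita_succ]
  split_ifs <;> module

theorem mixed_lie (hx : IsQuadTriple x) (i j k : Fin 3) : ⁅mixed K x i j, x k⁆ =
    (if i = j then (1 : K) else 0) • x k - (if i = k then (3 : K) else 0) • x j := by
  rw [← lie_skew, lie_mixed hx]; module

variable (K) in
/-- The mixed brackets have trace zero, by the Jacobi identity; no relation is needed. -/
theorem mixed_trace (x : Fin 3 → L) : mixed K x 2 2 = - mixed K x 0 0 - mixed K x 1 1 := by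
  have := lie_jacobi (x 0) (x 1) (x 2)
  have h : (2⁻¹ : K) • ⁅x 2, ⁅x 0, x 1⁆⁆ =
      -((2⁻¹ : K) • ⁅x 0, ⁅x 1, x 2⁆⁆) - (2⁻¹ : K) • ⁅x 1, ⁅x 2, x 0⁆⁆ := by
    linear_combination (norm := module) (2⁻¹ : K) • this
  simpa [mixed, dual] using h

theorem mixed_lie_dual (hx : IsQuadTriple x) (i j k : Fin 3) : ⁅mixed K x i j, dual K x k⁆ =
    (if j = k then (3 : K) else 0) • dual K x i - (if i = j then (1 : K) else 0) • dual K x k := by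
  have h0 := lie_succ K x 0
  have h1 := lie_succ K x 1
  have h2 := lie_succ K x 2
  have e {i j k} (h : ⁅x i, x j⁆ = (2 : K) • dual K x k) : ⁅x j, x i⁆ = (-2 : K) • dual K x k := by
    rw [← lie_skew, h, neg_smul]
  simp only [Fin.isValue, Fin.reduceAdd] at h0 h1 h2
  rw [dual, lie_smul, leibniz_lie, mixed_lie hx, mixed_lie hx]
  fin_cases i <;> fin_cases j <;> fin_cases k <;> simp [h0, h1, h2, e h0, e h1, e h2] <;> module

theorem mixed_lie_mixed (hx : IsQuadTriple x) (i j k l : Fin 3) : ⁅mixed K x i j, mixed K x k l⁆ =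
    (if j = k then (3 : K) else 0) • mixed K x i l -
      (if i = l then (3 : K) else 0) • mixed K x k j := by
  rw [mixed.eq_1 K x k l, leibniz_lie, mixed_lie hx, mixed_lie_dual hx]
  simp only [sub_lie, lie_sub, smul_lie, lie_smul]
  simp only [mixed]
  module

theorem dual_lie_dual (hx : IsQuadTriple x) (i : Fin 3) :
    ⁅dual K x i, dual K x (i + 1)⁆ = (2 : K) • x (i + 2) := by
  rw [dual, smul_lie, lie_lie, ← mixed, ← mixed, lie_mixed hx, lie_mixed hx]
  fin_cases i <;> simp <;> module
end

end

/-! ### The bracket table -/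

section
variable {K : Type*} [Field K] {L : Type*} [LieRing L] [LieAlgebra K L]

theorem y_eq (K : Type*) [Field K] : y K = dual K (x K) := rfl
theorem a_eq (K : Type*) [Field K] (i j : Fin 3) : a K i j = (3⁻¹ : K) • mixed K (x K) i j := rfl
theorem h₁_eq (K : Type*) [Field K] :
    h₁ K = (3⁻¹ : K) • (mixed K (x K) 0 0 - mixed K (x K) 1 1) := rfl
theorem h₂_eq (K : Type*) [Field K] :
    h₂ K = (3⁻¹ : K) • (mixed K (x K) 1 1 - mixed K (x K) 2 2) := rfl

variable (K) in
/-- The fourteen elements formed from an arbitrary triple `x`. -/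
def tableElt (x : Fin 3 → L) : Fin 14 → L :=
  ![(3⁻¹ : K) • (mixed K x 0 0 - mixed K x 1 1), (3⁻¹ : K) • (mixed K x 1 1 - mixed K x 2 2),
    (3⁻¹ : K) • mixed K x 0 1, (3⁻¹ : K) • mixed K x 0 2, (3⁻¹ : K) • mixed K x 1 2,
    (3⁻¹ : K) • mixed K x 1 0, (3⁻¹ : K) • mixed K x 2 0, (3⁻¹ : K) • mixed K x 2 1,
    x 0, x 1, x 2, dual K x 0, dual K x 1, dual K x 2]

theorem elt_eq (K : Type*) [Field K] : elt K = tableElt K (x K) := rfl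

end

set_option linter.unusedSimpArgs false in
set_option maxHeartbeats 1000000 in
theorem lie_tableElt {K : Type*} [Field K] [CharZero K] {L : Type u} [LieRing L] [LieAlgebra K L]
    {x : Fin 3 → L} (hx : IsQuadTriple x) (p q : Fin 14) (hpq : p ≤ q) :
    ⁅tableElt K x p, tableElt K x q⁆ = bracketTable (tableElt K x) p q := by
  have h0 := lie_succ K x 0
  have h1 := lie_succ K x 1
  have h2 := lie_succ K x 2
  have h0' := dual_lie_dual (K := K) hx 0
  have h1' := dual_lie_dual (K := K) hx 1
  have h2' := dual_lie_dual (K := K) hx 2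
  simp only [Fin.isValue, Fin.reduceAdd] at h0 h1 h2 h0' h1' h2'
  have e {u v w : L} (h : ⁅u, v⁆ = (2 : K) • w) : ⁅v, u⁆ = (-2 : K) • w := by
    rw [← lie_skew, h, neg_smul]
  have ht := mixed_trace K x
  have hb (i j : Fin 3) : ⁅x j, dual K x i⁆ = mixed K x i j := rfl
  fin_cases p <;> fin_cases q <;>
    first
    | exact absurd hpq (by decide)
    | ((try simp [tableElt, bracketTable, mixed_lie hx, mixed_lie_dual hx, mixed_lie_mixed hx, hb,
        h0, h1, h2, h0', h1', h2', e h0, e h1, e h2, e h0', e h1', e h2', ht]) <;> try module)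

/-! ### The seven-dimensional representation -/

section
open Matrix
attribute [local instance 100] LieRing.ofAssociativeRing

/-- The space `K × K³ × K³` of dimension seven, to be thought of as the imaginary split octonions:
the sum of the trivial representation of `sl(3)`, the dual of the standard one, and the standard
one. -/
abbrev Rep (K : Type*) : Type _ := K × (Fin 3 → K) × (Fin 3 → K)

variable {K : Type*} [Field K]

/-- The operator by which a vector `w` of the dual of `K³` acts on `Rep K`; the generators `x i`
act through the unit vectors. -/
def repX (w : Fin 3 → K) : Module.End K (Rep K) where
  toFun m := (-(w ⬝ᵥ m.2.2), (2 * m.1) • w, w ⨯₃ m.2.1)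
  map_add' m n := by ext <;> simp <;> ring
  map_smul' c m := by ext <;> simp <;> ring

/-- The operator by which a vector `z` of `K³` acts on `Rep K`; the elements `y i` act through the
unit vectors. -/
def repY (z : Fin 3 → K) : Module.End K (Rep K) where
  toFun m := (-(z ⬝ᵥ m.2.1), z ⨯₃ m.2.2, (2 * m.1) • z)
  map_add' m n := by ext <;> simp <;> ring
  map_smul' c m := by ext <;> simp <;> ring

theorem repX_apply (w : Fin 3 → K) (m : Rep K) :
    repX w m = (-(w ⬝ᵥ m.2.2), (2 * m.1) • w, w ⨯₃ m.2.1) := rfl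

theorem repY_apply (z : Fin 3 → K) (m : Rep K) :
    repY z m = (-(z ⬝ᵥ m.2.1), z ⨯₃ m.2.2, (2 * m.1) • z) := rfl

theorem repX_lie_repX (w w' : Fin 3 → K) : ⁅repX w, repX w'⁆ = (2 : K) • repY (w ⨯₃ w') := by
  refine LinearMap.ext fun m ↦ ?_
  simp only [Ring.lie_def, LinearMap.sub_apply, Module.End.mul_apply, LinearMap.smul_apply,
    repX_apply, repY_apply, cross_apply, vec3_dotProduct]
  refine Prod.ext ?_ (Prod.ext ?_ ?_)
  · simp; ring
  · ext i; fin_cases i <;> simp [vecHead, vecTail] <;> ring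
  · ext i; fin_cases i <;> simp [vecHead, vecTail] <;> ring

/-- The mixed brackets act by `-3` times the trace-free part of a rank-one matrix on the dual of
`K³` and by its negative transpose on `K³`. -/
theorem repX_lie_repY_apply (w z : Fin 3 → K) (m : Rep K) : ⁅repX w, repY z⁆ m =
    (0, (z ⬝ᵥ w) • m.2.1 - (3 * (z ⬝ᵥ m.2.1)) • w,
      (3 * (w ⬝ᵥ m.2.2)) • z - (w ⬝ᵥ z) • m.2.2) := by
  simp only [Ring.lie_def, LinearMap.sub_apply, Module.End.mul_apply,
    repX_apply, repY_apply, cross_apply, vec3_dotProduct]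
  refine Prod.ext ?_ (Prod.ext ?_ ?_)
  · simp; ring
  · ext i; fin_cases i <;> simp [vecHead, vecTail] <;> ring
  · ext i; fin_cases i <;> simp [vecHead, vecTail] <;> ring

theorem repX_lie_repX_lie_repY (k w z : Fin 3 → K) : ⁅repX k, ⁅repX w, repY z⁆⁆ =
    (3 * (z ⬝ᵥ k)) • repX w - (z ⬝ᵥ w) • repX k := by
  refine LinearMap.ext fun m ↦ ?_
  rw [Ring.lie_def]
  simp only [LinearMap.sub_apply, Module.End.mul_apply, LinearMap.smul_apply,
    repX_lie_repY_apply, repX_apply, cross_apply, vec3_dotProduct]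
  refine Prod.ext ?_ (Prod.ext ?_ ?_)
  · simp; ring
  · ext i; fin_cases i <;> simp [vecHead, vecTail] <;> ring
  · ext i; fin_cases i <;> simp [vecHead, vecTail] <;> ring

theorem isQuadTriple_repX : IsQuadTriple fun i ↦ repX (Pi.single i (1 : K)) := by
  have key (i j k : Fin 3) : (Pi.single i (1 : K) ⨯₃ Pi.single j (1 : K)) ⬝ᵥ Pi.single k (1 : K) =
      (leviCivita k i j : K) := by
    fin_cases i <;> fin_cases j <;> fin_cases k <;> simp [cross_apply, leviCivita]
  have hs (f g h : Module.End K (Rep K)) : ⁅f, ⁅g, (2 : K) • h⁆⁆ = (2 : K) • ⁅f, ⁅g, h⁆⁆ := by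
    have e (g h : Module.End K (Rep K)) : ⁅g, (2 : K) • h⁆ = (2 : K) • ⁅g, h⁆ :=
      LieAlgebra.lie_smul (R := K) (L := Module.End K (Rep K)) 2 g h
    rw [e, e]
  intro p q r s
  dsimp only
  rw [repX_lie_repX, hs, repX_lie_repX_lie_repY, key, key]
  module

/-- The coefficients of `x` and `y` are read off from the action on the vector `(1, 0, 0)`, the
remaining ones from the action on the first copy of `K³`. -/
theorem linearIndependent_elt [CharZero K] : LinearIndependent K (elt K) := by
  obtain ⟨ρ, hρ⟩ := exists_lieHom (K := K) (isQuadTriple_repX (K := K))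
  have hY (i) : ρ (y K i) = repY (Pi.single i 1) := by
    have : Pi.single (i + 1) (1 : K) ⨯₃ Pi.single (i + 2) (1 : K) = Pi.single i 1 := by
      ext j; fin_cases i <;> fin_cases j <;> simp [cross_apply]
    rw [y, map_smul, LieHom.map_lie, hρ, hρ, repX_lie_repX, this, smul_smul,
      inv_mul_cancel₀ two_ne_zero, one_smul]
  have hT (i j) (m : Rep K) : ρ (mixed K (x K) i j) m =
      (0, (Pi.single i (1 : K) ⬝ᵥ Pi.single j (1 : K)) • m.2.1 - (3 * m.2.1 i) • Pi.single j 1,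
      (3 * m.2.2 j) • Pi.single i 1 - (Pi.single i (1 : K) ⬝ᵥ Pi.single j 1) • m.2.2) := by
    rw [mixed, ← y_eq, LieHom.map_lie, hρ, hY, repX_lie_repY_apply]
    simp [dotProduct_comm]
  rw [Fintype.linearIndependent_iff]
  intro c hc
  have hm (m : Rep K) : ∑ p, c p • ρ (elt K p) m = 0 := by
    simpa only [map_sum, map_smul, LinearMap.sum_apply, LinearMap.smul_apply, map_zero,
      LinearMap.zero_apply] using congrArg (fun v ↦ ρ v m) hc
  have h0 := hm (1, 0, 0)
  have hu (i) := hm (0, Pi.single i 1, 0)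
  simp [elt_eq, tableElt, ← y_eq, Fin.sum_univ_succ, repX_apply, repY_apply, hρ, hY, hT] at h0
  simp [elt_eq, tableElt, ← y_eq, Fin.sum_univ_succ, repX_apply, repY_apply, hρ, hY, hT] at hu
  have hx (j) := congrFun h0.1 j
  have hy (j) := congrFun h0.2 j
  have ha (i j) := congrFun (hu i).2.1 j
  have hx0 := hx 0
  have hx1 := hx 1
  have hx2 := hx 2
  have hy0 := hy 0
  have hy1 := hy 1
  have hy2 := hy 2
  -- The entries off the diagonal give the coefficients of the `a i j`; the entries `(0, 0)` and
  -- `(2, 2)` give those of `h₁` and `h₂`.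
  have ha00 := ha 0 0
  have ha01 := ha 0 1
  have ha02 := ha 0 2
  have ha10 := ha 1 0
  have ha12 := ha 1 2
  have ha20 := ha 2 0
  have ha21 := ha 2 1
  have ha22 := ha 2 2
  simp at hx0 hx1 hx2 hy0 hy1 hy2 ha00 ha01 ha02 ha10 ha12 ha20 ha21 ha22
  intro p
  fin_cases p <;> assumption

end

/-! ### The basis -/

section
theorem bracketTable_mem_span {K : Type*} [Field K] {L : Type u} [AddCommGroup L]
    [Module K L] (v : Fin 14 → L) (p q : Fin 14) :
    bracketTable v p q ∈ Submodule.span K (Set.range v) := by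
  have hv (r : Fin 14) : v r ∈ Submodule.span K (Set.range v) :=
    Submodule.subset_span ⟨r, rfl⟩
  generalize Submodule.span K (Set.range v) = S at hv
  fin_cases p <;> fin_cases q <;> simp only [bracketTable] <;>
    repeat' first
      | exact S.zero_mem
      | exact hv _
      | refine S.neg_mem ?_
      | refine S.smul_of_tower_mem _ ?_
      | refine S.add_mem ?_ ?_
      | refine S.sub_mem ?_ ?_

variable {K : Type u} [Field K] [CharZero K]

theorem lie_elt (p q : Fin 14) (hpq : p ≤ q) : ⁅elt K p, elt K q⁆ = bracketTable (elt K) p q :=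
  lie_tableElt (x_isQuadTriple K) p q hpq

theorem span_elt : Submodule.span K (Set.range (elt K)) = ⊤ := by
  have hmem (p q : Fin 14) : ⁅elt K p, elt K q⁆ ∈ Submodule.span K (Set.range (elt K)) := by
    rcases le_total p q with h | h
    · rw [lie_elt p q h]
      exact bracketTable_mem_span _ p q
    · rw [← lie_skew, lie_elt q p h]
      exact neg_mem (bracketTable_mem_span _ q p)
  let S : LieSubalgebra K (QuadAlg K) :=
    { Submodule.span K (Set.range (elt K)) with
      lie_mem' := by
        intro u v hu hv
        change u ∈ Submodule.span K (Set.range (elt K)) at hu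
        change v ∈ Submodule.span K (Set.range (elt K)) at hv
        change ⁅u, v⁆ ∈ Submodule.span K (Set.range (elt K))
        induction hu, hv using Submodule.span_induction₂ with
        | mem_mem u v hu hv =>
          obtain ⟨p, rfl⟩ := hu
          obtain ⟨q, rfl⟩ := hv
          exact hmem p q
        | zero_left => simp
        | zero_right => simp
        | add_left _ _ _ _ _ _ h₁ h₂ => rw [add_lie]; exact add_mem h₁ h₂
        | add_right _ _ _ _ _ _ h₁ h₂ => rw [lie_add]; exact add_mem h₁ h₂
        | smul_left r _ _ _ _ h => rw [smul_lie]; exact Submodule.smul_mem _ r h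
        | smul_right r _ _ _ _ h => rw [lie_smul]; exact Submodule.smul_mem _ r h }
  have hS : S = ⊤ := eq_top_of_mk_of_mem S fun i ↦ by
    refine Submodule.subset_span ?_
    fin_cases i
    exacts [⟨8, rfl⟩, ⟨9, rfl⟩, ⟨10, rfl⟩]
  refine eq_top_iff.2 fun v _ ↦ ?_
  have : v ∈ S := hS ▸ LieSubalgebra.mem_top v
  exact this

variable (K) in
/-- The fourteen elements as a basis. -/
noncomputable def eltBasis : Module.Basis (Fin 14) K (QuadAlg K) :=
  Module.Basis.mk linearIndependent_elt span_elt.ge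

theorem eltBasis_apply (p : Fin 14) : eltBasis K p = elt K p :=
  Module.Basis.mk_apply _ _ p

theorem finrank_quadAlg : Module.finrank K (QuadAlg K) = 14 := by
  simp [Module.finrank_eq_card_basis (eltBasis K)]

end

/-! ### Simplicity -/

section
section
variable {K : Type*} [Field K] {L : Type*} [LieRing L] [LieAlgebra K L]

variable (K) in
/-- The element `Σ M i j • ⁅x j, y i⁆` attached to a matrix `M`. -/
def mixedSum (x : Fin 3 → L) : Matrix (Fin 3) (Fin 3) K →ₗ[K] L where
  toFun M := ∑ i, ∑ j, M i j • mixed K x i j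
  map_add' M N := by simp [add_smul, Finset.sum_add_distrib]
  map_smul' c M := by simp [Finset.smul_sum, smul_smul]

theorem mixedSum_apply (x : Fin 3 → L) (M : Matrix (Fin 3) (Fin 3) K) :
    mixedSum K x M = ∑ i, ∑ j, M i j • mixed K x i j := rfl

variable (K) in
/-- The span of the `x i` and `y i`, that is, of the root vectors for the short roots. -/
def shortSpan (x : Fin 3 → L) : Submodule K L :=
  Submodule.span K (Set.range x ∪ Set.range (dual K x))

variable (K) in
theorem x_mem_shortSpan (x : Fin 3 → L) (i : Fin 3) : x i ∈ shortSpan K x :=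
  Submodule.subset_span (.inl ⟨i, rfl⟩)

variable (K) in
theorem dual_mem_shortSpan (x : Fin 3 → L) (i : Fin 3) : dual K x i ∈ shortSpan K x :=
  Submodule.subset_span (.inr ⟨i, rfl⟩)

variable [CharZero K] {x : Fin 3 → L}

theorem mixedSum_lie (hx : IsQuadTriple x) (M : Matrix (Fin 3) (Fin 3) K) (k : Fin 3) :
    ⁅mixedSum K x M, x k⁆ = M.trace • x k - (3 : K) • ∑ j, M k j • x j := by
  simp only [mixedSum_apply, Matrix.trace, Matrix.diag, sum_lie, smul_lie, mixed_lie hx, smul_sub,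
    Finset.sum_sub_distrib, ite_smul, zero_smul]
  simp [Finset.sum_smul, Finset.smul_sum, smul_smul, mul_comm]

theorem mixedSum_lie_dual (hx : IsQuadTriple x) (M : Matrix (Fin 3) (Fin 3) K) (k : Fin 3) :
    ⁅mixedSum K x M, dual K x k⁆ =
      (3 : K) • ∑ i, M i k • dual K x i - M.trace • dual K x k := by
  simp only [mixedSum_apply, Matrix.trace, Matrix.diag, sum_lie, smul_lie, mixed_lie_dual hx,
    smul_sub, Finset.sum_sub_distrib, ite_smul, zero_smul]
  simp [Finset.sum_smul, Finset.smul_sum, smul_smul, mul_comm]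

theorem mixedSum_lie_mixed (hx : IsQuadTriple x) (M : Matrix (Fin 3) (Fin 3) K) (k l : Fin 3) :
    ⁅mixedSum K x M, mixed K x k l⁆ =
      (3 : K) • ∑ i, M i k • mixed K x i l - (3 : K) • ∑ j, M l j • mixed K x k j := by
  simp only [mixedSum_apply, sum_lie, smul_lie, mixed_lie_mixed hx, smul_sub,
    Finset.sum_sub_distrib, ite_smul, zero_smul]
  simp [Finset.smul_sum, smul_smul, mul_comm]

theorem mixedSum_lie_mixedSum (hx : IsQuadTriple x) (M N : Matrix (Fin 3) (Fin 3) K) :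
    ⁅mixedSum K x M, mixedSum K x N⁆ = (3 : K) • mixedSum K x (M * N - N * M) := by
  rw [mixedSum_apply x N]
  simp only [lie_sum, lie_smul, mixedSum_lie_mixed hx]
  simp only [map_sub, mixedSum_apply, Matrix.mul_apply, Fin.sum_univ_three]
  module

variable (K) in
theorem x_lie_x_mem_shortSpan (x : Fin 3 → L) (i j : Fin 3) : ⁅x i, x j⁆ ∈ shortSpan K x := by
  have h (i : Fin 3) : ⁅x i, x (i + 1)⁆ ∈ shortSpan K x :=
    lie_succ K x i ▸ Submodule.smul_mem _ _ (dual_mem_shortSpan K x _)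
  obtain rfl | rfl | rfl : j = i ∨ j = i + 1 ∨ i = j + 1 := by omega
  · simp
  · exact h i
  · exact lie_skew (x (j + 1)) (x j) ▸ neg_mem (h j)

theorem dual_lie_dual_mem_shortSpan (hx : IsQuadTriple x) (i j : Fin 3) :
    ⁅dual K x i, dual K x j⁆ ∈ shortSpan K x := by
  have h (i : Fin 3) : ⁅dual K x i, dual K x (i + 1)⁆ ∈ shortSpan K x :=
    dual_lie_dual (K := K) hx i ▸ Submodule.smul_mem _ _ (x_mem_shortSpan K x _)
  obtain rfl | rfl | rfl : j = i ∨ j = i + 1 ∨ i = j + 1 := by omega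
  · simp
  · exact h i
  · exact lie_skew (dual K x (j + 1)) (dual K x j) ▸ neg_mem (h j)

/-- For `i ≠ j` the element `⁅x j, y i⁆` is a root vector for a long root `α`. If `β` is a short
root, then `β + 2α` is not a root. -/
theorem mixed_lie_mixed_lie_of_mem_shortSpan (hx : IsQuadTriple x) {i j : Fin 3} (h : i ≠ j)
    {v : L} (hv : v ∈ shortSpan K x) : ⁅mixed K x i j, ⁅mixed K x i j, v⁆⁆ = 0 := by
  induction hv using Submodule.span_induction with
  | mem v hv =>
    obtain ⟨k, rfl⟩ | ⟨k, rfl⟩ := hv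
    · rw [mixed_lie hx, if_neg h]
      split_ifs <;> simp [mixed_lie hx, h]
    · rw [mixed_lie_dual hx, if_neg h]
      split_ifs <;> simp [mixed_lie_dual hx, h, h.symm]
  | zero => simp
  | add _ _ _ _ h₁ h₂ => simp [h₁, h₂]
  | smul c _ _ h => simp [h]

/-- If `α` is the long root that belongs to `⁅x j, y i⁆`, and `β` is a long root or zero, then
`β + 2α` is a root only if `β = -α`, the root that belongs to `⁅x i, y j⁆`. -/
theorem mixed_lie_mixed_lie_mixedSum (hx : IsQuadTriple x) {i j : Fin 3} (h : i ≠ j)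
    (M : Matrix (Fin 3) (Fin 3) K) :
    ⁅mixed K x i j, ⁅mixed K x i j, mixedSum K x M⁆⁆ = (-18 * M j i) • mixed K x i j := by
  rw [← lie_skew _ (mixedSum K x M), mixedSum_lie_mixed hx]
  simp only [lie_neg, lie_sub, lie_smul, lie_sum, mixed_lie_mixed hx, h, h.symm, if_false, smul_sub,
    Finset.sum_sub_distrib, ite_smul, smul_ite, zero_smul, smul_zero, Finset.sum_ite_eq,
    Finset.sum_const_zero, Finset.mem_univ, if_true]
  module

/-- An ideal containing one generator contains all of them. -/
theorem x_mem_of_x_mem (hx : IsQuadTriple x) {I : LieIdeal K L} {j : Fin 3} (h : x j ∈ I)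
    (l : Fin 3) : x l ∈ I := by
  obtain rfl | hl := eq_or_ne j l
  · exact h
  · have := lie_mem_right K L I (mixed K x j l) _ h
    rw [mixed_lie hx] at this
    simp only [hl, if_false, if_true, zero_smul, zero_sub, neg_mem_iff] at this
    exact (Submodule.smul_mem_iff _ (three_ne_zero)).1 this

theorem x_mem_of_mixed_mem (hx : IsQuadTriple x) {I : LieIdeal K L} {i j : Fin 3} (hij : i ≠ j)
    (h : mixed K x i j ∈ I) (l : Fin 3) : x l ∈ I := by
  refine x_mem_of_x_mem (K := K) hx (j := j) ?_ l
  have := lie_mem_right K L I (x i) _ h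
  rw [lie_mixed hx] at this
  simp only [hij, if_false, if_true, zero_smul, sub_zero] at this
  exact (Submodule.smul_mem_iff _ (three_ne_zero)).1 this

/-- An ideal that does not contain all generators has no element with a nonzero coefficient at a
long root vector. -/
theorem coeff_eq_zero (hx : IsQuadTriple x) {I : LieIdeal K L} (hI : ∃ l, x l ∉ I)
    {v : L} (hvI : v ∈ I) {M : Matrix (Fin 3) (Fin 3) K}
    (hv : v - mixedSum K x M ∈ shortSpan K x) {i j : Fin 3} (h : j ≠ i) : M i j = 0 := by
  by_contra hM
  obtain ⟨l, hl⟩ := hI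
  refine hl (x_mem_of_mixed_mem hx h ?_ l)
  have := lie_mem_right K L I (mixed K x j i) _ (lie_mem_right K L I (mixed K x j i) _ hvI)
  rw [← sub_add_cancel v (mixedSum K x M), lie_add, lie_add,
    mixed_lie_mixed_lie_of_mem_shortSpan hx h hv, mixed_lie_mixed_lie_mixedSum hx h, zero_add] at this
  exact (Submodule.smul_mem_iff _ (mul_ne_zero (by norm_num) hM)).1 this

/-- An ideal that does not contain all generators is zero: the coefficients of an element vanish
first at the long root vectors, then at the short ones (after a bracket that moves them to long
roots), and then on the diagonal. -/
theorem eq_zero_of_mem (hx : IsQuadTriple x) {I : LieIdeal K L} (hI : ∃ l, x l ∉ I)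
    {M : Matrix (Fin 3) (Fin 3) K} {u w : Fin 3 → K} {v : L}
    (hv : v = mixedSum K x M + (∑ i, u i • x i + ∑ i, w i • dual K x i)) (hvI : v ∈ I) : v = 0 := by
  have hM (i j : Fin 3) (h : j ≠ i) : M i j = 0 := by
    refine coeff_eq_zero hx hI hvI ?_ h
    rw [hv, add_sub_cancel_left]
    exact add_mem (sum_mem fun i _ ↦ Submodule.smul_mem _ _ (x_mem_shortSpan K x i))
      (sum_mem fun i _ ↦ Submodule.smul_mem _ _ (dual_mem_shortSpan K x i))
  -- The bracket with `x (i + 1)` moves the coefficient of `y i` to a long root vector.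
  have hw (i : Fin 3) : w i = 0 := by
    have e : ⁅x (i + 1), v⁆ - mixedSum K x (Matrix.of fun k l ↦ if l = i + 1 then w k else 0) =
        ⁅x (i + 1), mixedSum K x M⁆ + ∑ k, u k • ⁅x (i + 1), x k⁆ := by
      rw [hv, mixedSum_apply x (Matrix.of _)]
      simp [lie_sum, mixed]
      abel
    have := coeff_eq_zero hx hI (lie_mem_right K L I (x (i + 1)) _ hvI)
      (M := Matrix.of fun k l ↦ if l = i + 1 then w k else 0) (i := i) (j := i + 1)
      (e ▸ ?_) (by simp)
    · simpa using this
    refine add_mem ?_ (sum_mem fun k _ ↦ Submodule.smul_mem _ _ (x_lie_x_mem_shortSpan K x _ k))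
    rw [← lie_skew, mixedSum_lie hx]
    exact neg_mem (sub_mem (Submodule.smul_mem _ _ (x_mem_shortSpan K x _)) (Submodule.smul_mem _ _
      (sum_mem fun k _ ↦ Submodule.smul_mem _ _ (x_mem_shortSpan K x k))))
  -- Likewise for the coefficient of `x i` and the bracket with `y (i + 1)`.
  have hu (i : Fin 3) : u i = 0 := by
    have e : ⁅dual K x (i + 1), v⁆ -
        mixedSum K x (Matrix.of fun k l ↦ if k = i + 1 then -u l else 0) =
        ⁅dual K x (i + 1), mixedSum K x M⁆ + ∑ k, w k • ⁅dual K x (i + 1), dual K x k⁆ := by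
      have hb (k : Fin 3) : ⁅dual K x (i + 1), x k⁆ = - mixed K x (i + 1) k := by
        rw [mixed, lie_skew]
      rw [hv, mixedSum_apply x (Matrix.of _)]
      simp [lie_sum, hb]
      abel
    have := coeff_eq_zero hx hI (lie_mem_right K L I (dual K x (i + 1)) _ hvI)
      (M := Matrix.of fun k l ↦ if k = i + 1 then -u l else 0) (i := i + 1) (j := i)
      (e ▸ ?_) (by simp)
    · simpa using this
    refine add_mem ?_
      (sum_mem fun k _ ↦ Submodule.smul_mem _ _ (dual_lie_dual_mem_shortSpan hx _ k))
    rw [← lie_skew, mixedSum_lie_dual hx]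
    exact neg_mem (sub_mem (Submodule.smul_mem _ _
      (sum_mem fun k _ ↦ Submodule.smul_mem _ _ (dual_mem_shortSpan K x k)))
      (Submodule.smul_mem _ _ (dual_mem_shortSpan K x _)))
  -- A diagonal element scales `x k` by `M.trace - 3 * M k k`.
  have hdiag (k : Fin 3) : M.trace = 3 * M k k := by
    by_contra hk
    obtain ⟨l, hl⟩ := hI
    refine hl (x_mem_of_x_mem (K := K) hx (j := k) ?_ l)
    have := lie_mem_left K L I _ (x k) hvI
    simp only [hv, hu, hw, zero_smul, Finset.sum_const_zero, add_zero] at this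
    rw [mixedSum_lie hx, Finset.sum_eq_single k (fun j _ hj ↦ by rw [hM k j hj, zero_smul])
      (by simp), smul_smul, ← sub_smul] at this
    exact (Submodule.smul_mem_iff _ (sub_ne_zero.2 hk)).1 this
  -- A scalar matrix gives zero, since the mixed brackets have trace zero.
  have h1 : M 1 1 = M 0 0 := mul_left_cancel₀ three_ne_zero ((hdiag 1).symm.trans (hdiag 0))
  have h2 : M 2 2 = M 0 0 := mul_left_cancel₀ three_ne_zero ((hdiag 2).symm.trans (hdiag 0))
  rw [hv]
  simp [mixedSum_apply, Fin.sum_univ_three, hM, hu, hw, h1, h2, mixed_trace K x, smul_sub]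

end

variable {K : Type u} [Field K] [CharZero K]

theorem exists_eq_mixedSum_add (v : QuadAlg K) : ∃ (M : Matrix (Fin 3) (Fin 3) K) (u w : Fin 3 → K),
    v = mixedSum K (x K) M + (∑ i, u i • x K i + ∑ i, w i • dual K (x K) i) := by
  obtain ⟨c, rfl⟩ := Submodule.mem_span_range_iff_exists_fun K |>.1
    (span_elt (K := K) ▸ Submodule.mem_top : v ∈ Submodule.span K (Set.range (elt K)))
  refine ⟨!![c 0 / 3, c 2 / 3, c 3 / 3;
             c 5 / 3, (c 1 - c 0) / 3, c 4 / 3;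
             c 6 / 3, c 7 / 3, -c 1 / 3],
    ![c 8, c 9, c 10], ![c 11, c 12, c 13], ?_⟩
  simp [elt_eq, tableElt, mixedSum_apply, Fin.sum_univ_succ]
  module

theorem isSimple_quadAlg : LieAlgebra.IsSimple K (QuadAlg K) where
  eq_bot_or_eq_top I := by
    by_cases hI : ∀ l, x K l ∈ I
    · right
      have := eq_top_of_mk_of_mem (I : LieSubalgebra K (QuadAlg K)) hI
      refine eq_top_iff.2 fun v _ ↦ ?_
      have hv : v ∈ (I : LieSubalgebra K (QuadAlg K)) := this ▸ LieSubalgebra.mem_top v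
      exact hv
    · left
      push Not at hI
      refine (LieSubmodule.eq_bot_iff I).2 fun v hv ↦ ?_
      obtain ⟨M, u, w, h⟩ := exists_eq_mixedSum_add v
      exact eq_zero_of_mem (x_isQuadTriple K) hI h hv
  non_abelian h := by
    have h1 : elt K 11 = 0 := by
      change (2⁻¹ : K) • ⁅x K (0 + 1), x K (0 + 2)⁆ = 0
      rw [h.trivial, smul_zero]
    exact linearIndependent_elt.ne_zero 11 h1

end

/-! ### The embedding of `sl(3)` -/

section
theorem trace_sl_eq_zero {K : Type*} [Field K] (A : LieAlgebra.SpecialLinear.sl (Fin 3) K) :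
    A.1.trace = 0 := A.2

variable {K : Type u} [Field K] [CharZero K]

variable (K) in
/-- The homomorphism from `sl(3)`, given by `A ↦ 1/3 Σ A i j • ⁅x j, y i⁆`. -/
noncomputable def slHom : LieAlgebra.SpecialLinear.sl (Fin 3) K →ₗ⁅K⁆ QuadAlg K where
  toFun A := (3⁻¹ : K) • mixedSum K (x K) A.1
  map_add' A B := (congrArg _ (map_add (mixedSum K (x K)) A.1 B.1)).trans (smul_add _ _ _)
  map_smul' c A := (congrArg _ (map_smul (mixedSum K (x K)) c A.1)).trans (smul_comm _ _ _)
  map_lie' {A B} := by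
    change (3⁻¹ : K) • mixedSum K (x K) (A.1 * B.1 - B.1 * A.1) =
      ⁅(3⁻¹ : K) • mixedSum K (x K) A.1, (3⁻¹ : K) • mixedSum K (x K) B.1⁆
    rw [lie_smul, smul_lie, mixedSum_lie_mixedSum (x_isQuadTriple K), smul_smul (3⁻¹ : K) (3 : K),
      inv_mul_cancel₀ three_ne_zero, one_smul]

theorem slHom_apply (A : LieAlgebra.SpecialLinear.sl (Fin 3) K) :
    slHom K A = (3⁻¹ : K) • mixedSum K (x K) A.1 := rfl

theorem slHom_lie_x (A : LieAlgebra.SpecialLinear.sl (Fin 3) K) (k : Fin 3) :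
    ⁅slHom K A, x K k⁆ = -∑ j : Fin 3, A.1 k j • x K j := by
  rw [slHom_apply, smul_lie, mixedSum_lie (x_isQuadTriple K), trace_sl_eq_zero]
  module

theorem slHom_lie_y (A : LieAlgebra.SpecialLinear.sl (Fin 3) K) (k : Fin 3) :
    ⁅slHom K A, y K k⁆ = ∑ i : Fin 3, A.1 i k • y K i := by
  rw [slHom_apply, smul_lie, y_eq, mixedSum_lie_dual (x_isQuadTriple K), trace_sl_eq_zero]
  module

theorem slHom_eq (A : LieAlgebra.SpecialLinear.sl (Fin 3) K) :
    slHom K A = A.1 0 0 • h₁ K - A.1 2 2 • h₂ K +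
      ∑ i : Fin 3, ∑ j : Fin 3, if i = j then 0 else A.1 i j • a K i j := by
  have h2 : A.1 1 1 = - A.1 0 0 - A.1 2 2 := by
    have := trace_sl_eq_zero A
    rw [Matrix.trace_fin_three] at this
    linear_combination this
  rw [slHom_apply, mixedSum_apply]
  simp [Fin.sum_univ_three, a_eq, h₁_eq, h₂_eq, h2]
  module

theorem linearIndependent_x : LinearIndependent K (x K) := by
  have h : elt K ∘ ![8, 9, 10] = x K := by
    ext i; fin_cases i <;> rfl
  exact h ▸ linearIndependent_elt.comp ![8, 9, 10] (by decide)

theorem slHom_injective : Function.Injective (slHom K) := by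
  refine (injective_iff_map_eq_zero (slHom K)).2 fun A hA ↦ Subtype.ext (Matrix.ext fun k j ↦ ?_)
  have h0 := slHom_lie_x A k
  rw [hA, zero_lie, zero_eq_neg] at h0
  exact Fintype.linearIndependent_iff.1 linearIndependent_x _ h0 j

end

/-! ### Lie algebras with Serre relations of type `G₂` -/

open CartanMatrix

section
variable (K : Type*) [Field K] {L : Type*} [LieRing L] [LieAlgebra K L]

/-- Elements `e i`, `f i`, `h i` of a Lie algebra that satisfy the Serre relations of type `G₂`.
In the convention of `CartanMatrix.G₂` the simple root with index `0` is the short one. -/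
structure IsG2System (e f h : Fin 2 → L) : Prop where
  h_h : ⁅h 0, h 1⁆ = 0
  e_f (i j : Fin 2) : ⁅e i, f j⁆ = if i = j then h i else 0
  h_e (i j : Fin 2) : ⁅h i, e j⁆ = (CartanMatrix.G₂ i j : K) • e j
  h_f (i j : Fin 2) : ⁅h i, f j⁆ = -((CartanMatrix.G₂ i j : K) • f j)
  e_e : ⁅e 0, ⁅e 0, ⁅e 0, ⁅e 0, e 1⁆⁆⁆⁆ = 0
  e_e' : ⁅e 1, ⁅e 1, e 0⁆⁆ = 0
  f_f : ⁅f 0, ⁅f 0, ⁅f 0, ⁅f 0, f 1⁆⁆⁆⁆ = 0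
  f_f' : ⁅f 1, ⁅f 1, f 0⁆⁆ = 0

/-- Root vectors for the six positive roots, as iterated brackets of the `e i`. -/
def posElt (e : Fin 2 → L) : Fin 6 → L :=
  ![e 0, e 1, ⁅e 0, e 1⁆, ⁅e 0, ⁅e 0, e 1⁆⁆, ⁅e 0, ⁅e 0, ⁅e 0, e 1⁆⁆⁆,
    ⁅e 1, ⁅e 0, ⁅e 0, ⁅e 0, e 1⁆⁆⁆⁆]

variable {K} {e f h : Fin 2 → L}

/-- The Chevalley involution at the level of generators. -/
theorem IsG2System.swap (H : IsG2System K e f h) : IsG2System K f e (-h) where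
  h_h := by simp [H.h_h]
  e_f i j := by
    rw [← lie_skew, H.e_f]
    by_cases hij : i = j
    · subst hij; simp
    · simp [hij, Ne.symm hij]
  h_e i j := by simp [H.h_f]
  h_f i j := by simp [H.h_e]
  e_e := H.f_f
  e_e' := H.f_f'
  f_f := H.e_e
  f_f' := H.e_e'

/-- The span of the positive root vectors is stable under the raising operators. -/
theorem IsG2System.lie_posElt_mem [CharZero K] (H : IsG2System K e f h) {S : Submodule K L}
    (hm : ∀ k, posElt e k ∈ S) (i : Fin 2) (k : Fin 6) : ⁅e i, posElt e k⁆ ∈ S := by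
  have h1a : ⁅e 1, ⁅e 0, e 1⁆⁆ = 0 := by rw [← lie_skew (e 0), lie_neg, H.e_e', neg_zero]
  have h1b : ⁅e 1, ⁅e 0, ⁅e 0, e 1⁆⁆⁆ = 0 := by
    rw [leibniz_lie, h1a, lie_zero, add_zero, ← lie_skew (e 1) (e 0), neg_lie, lie_self, neg_zero]
  have h1c : ⁅e 1, ⁅e 0, ⁅e 0, ⁅e 0, e 1⁆⁆⁆⁆ = -⁅⁅e 0, e 1⁆, ⁅e 0, ⁅e 0, e 1⁆⁆⁆ := by
    rw [leibniz_lie, h1b, lie_zero, add_zero, ← lie_skew (e 1) (e 0), neg_lie]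
  -- The Jacobi identity gives this bracket in two ways, which differ by a sign.
  have h0d : ⁅e 0, ⁅e 1, ⁅e 0, ⁅e 0, ⁅e 0, e 1⁆⁆⁆⁆⁆ = 0 := by
    have e1 : ⁅e 0, ⁅e 1, ⁅e 0, ⁅e 0, ⁅e 0, e 1⁆⁆⁆⁆⁆ = ⁅⁅e 0, e 1⁆, ⁅e 0, ⁅e 0, ⁅e 0, e 1⁆⁆⁆⁆ := by
      rw [leibniz_lie, H.e_e, lie_zero, add_zero]
    have e2 : ⁅e 0, ⁅e 1, ⁅e 0, ⁅e 0, ⁅e 0, e 1⁆⁆⁆⁆⁆ = -⁅⁅e 0, e 1⁆, ⁅e 0, ⁅e 0, ⁅e 0, e 1⁆⁆⁆⁆ := by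
      rw [h1c, lie_neg, leibniz_lie, lie_self, zero_add]
    rw [← e1] at e2
    have e3 : (2 : K) • ⁅e 0, ⁅e 1, ⁅e 0, ⁅e 0, ⁅e 0, e 1⁆⁆⁆⁆⁆ = 0 := by
      rw [two_smul]
      nth_rewrite 1 [e2]
      exact neg_add_cancel _
    exact (smul_eq_zero.1 e3).resolve_left two_ne_zero
  have h1d : ⁅e 1, ⁅e 1, ⁅e 0, ⁅e 0, ⁅e 0, e 1⁆⁆⁆⁆⁆ = 0 := by
    rw [h1c, lie_neg, leibniz_lie, h1a, h1b, zero_lie, lie_zero, add_zero, neg_zero]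
  fin_cases i <;> fin_cases k <;> simp [posElt, H.e_e, h1a, h1b, h0d, h1d]
  · exact hm 2
  · exact hm 3
  · exact hm 4
  · exact lie_skew (e 1) (e 0) ▸ neg_mem (hm 2)
  · exact hm 5

/-- The lowering operators map the positive root vectors into the span of these vectors and of the
`h i`. -/
theorem IsG2System.lie_posElt_mem' (H : IsG2System K e f h) {S : Submodule K L}
    (hm : ∀ k, posElt e k ∈ S) (hh : ∀ i, h i ∈ S) (i : Fin 2) (k : Fin 6) :
    ⁅f i, posElt e k⁆ ∈ S := by
  have hfe (i j : Fin 2) : ⁅f i, e j⁆ = if i = j then -h i else 0 := by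
    rw [← lie_skew, H.e_f]
    by_cases hij : i = j
    · subst hij; simp
    · simp [hij, Ne.symm hij]
  have h00 : ⁅h 0, e 0⁆ = (2 : K) • e 0 := by simpa [CartanMatrix.G₂] using H.h_e 0 0
  have h01 : ⁅h 0, e 1⁆ = (-3 : K) • e 1 := by simpa [CartanMatrix.G₂] using H.h_e 0 1
  have h10 : ⁅h 1, e 0⁆ = -e 0 := by simpa [CartanMatrix.G₂] using H.h_e 1 0
  have h11 : ⁅h 1, e 1⁆ = (2 : K) • e 1 := by simpa [CartanMatrix.G₂] using H.h_e 1 1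
  have e0h1 : ⁅e 0, h 1⁆ = e 0 := by rw [← lie_skew, h10, neg_neg]
  have h1a : ⁅e 1, ⁅e 0, e 1⁆⁆ = 0 := by rw [← lie_skew (e 0), lie_neg, H.e_e', neg_zero]
  have h1b : ⁅e 1, ⁅e 0, ⁅e 0, e 1⁆⁆⁆ = 0 := by
    rw [leibniz_lie, h1a, lie_zero, add_zero, ← lie_skew (e 1) (e 0), neg_lie, lie_self, neg_zero]
  have h0a : ⁅h 0, ⁅e 0, e 1⁆⁆ = (-1 : K) • ⁅e 0, e 1⁆ := by
    rw [leibniz_lie, h00, h01, smul_lie, lie_smul]; module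
  have h0b : ⁅h 0, ⁅e 0, ⁅e 0, e 1⁆⁆⁆ = (1 : K) • ⁅e 0, ⁅e 0, e 1⁆⁆ := by
    rw [leibniz_lie, h00, h0a, smul_lie, lie_smul]; module
  have h1a' : ⁅h 1, ⁅e 0, e 1⁆⁆ = (1 : K) • ⁅e 0, e 1⁆ := by
    rw [leibniz_lie, h10, h11, neg_lie, lie_smul]; module
  have h1b' : ⁅h 1, ⁅e 0, ⁅e 0, e 1⁆⁆⁆ = (0 : K) • ⁅e 0, ⁅e 0, e 1⁆⁆ := by
    rw [leibniz_lie, h10, h1a', neg_lie, lie_smul]; module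
  have h1c' : ⁅h 1, ⁅e 0, ⁅e 0, ⁅e 0, e 1⁆⁆⁆⁆ = (-1 : K) • ⁅e 0, ⁅e 0, ⁅e 0, e 1⁆⁆⁆ := by
    rw [leibniz_lie, h10, h1b', neg_lie, lie_smul]; module
  have f0a : ⁅f 0, ⁅e 0, e 1⁆⁆ = (3 : K) • e 1 := by
    rw [leibniz_lie, hfe, hfe, if_pos rfl, if_neg (by decide), neg_lie, h01, lie_zero]; module
  have f0b : ⁅f 0, ⁅e 0, ⁅e 0, e 1⁆⁆⁆ = (4 : K) • ⁅e 0, e 1⁆ := by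
    rw [leibniz_lie, hfe, if_pos rfl, neg_lie, h0a, f0a, lie_smul]; module
  have f0c : ⁅f 0, ⁅e 0, ⁅e 0, ⁅e 0, e 1⁆⁆⁆⁆ = (3 : K) • ⁅e 0, ⁅e 0, e 1⁆⁆ := by
    rw [leibniz_lie, hfe, if_pos rfl, neg_lie, h0b, f0b, lie_smul]; module
  have f0d : ⁅f 0, ⁅e 1, ⁅e 0, ⁅e 0, ⁅e 0, e 1⁆⁆⁆⁆⁆ = 0 := by
    rw [leibniz_lie, hfe, if_neg (by decide), zero_lie, f0c, lie_smul, h1b, smul_zero, add_zero]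
  have f1a : ⁅f 1, ⁅e 0, e 1⁆⁆ = -e 0 := by
    rw [leibniz_lie, hfe, hfe, if_pos rfl, if_neg (by decide), zero_lie, lie_neg, e0h1, zero_add]
  have f1b : ⁅f 1, ⁅e 0, ⁅e 0, e 1⁆⁆⁆ = 0 := by
    rw [leibniz_lie, hfe, if_neg (by decide), zero_lie, f1a, lie_neg, lie_self, neg_zero, add_zero]
  have f1c : ⁅f 1, ⁅e 0, ⁅e 0, ⁅e 0, e 1⁆⁆⁆⁆ = 0 := by
    rw [leibniz_lie, hfe, if_neg (by decide), zero_lie, f1b, lie_zero, add_zero]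
  have f1d : ⁅f 1, ⁅e 1, ⁅e 0, ⁅e 0, ⁅e 0, e 1⁆⁆⁆⁆⁆ = ⁅e 0, ⁅e 0, ⁅e 0, e 1⁆⁆⁆ := by
    rw [leibniz_lie, hfe, if_pos rfl, neg_lie, h1c', f1c, lie_zero]; module
  fin_cases i <;> fin_cases k <;> simp [posElt, hfe, f0a, f0b, f0c, f0d, f1a, f1b, f1c, f1d, hh]
  · exact S.smul_mem _ (hm 1)
  · exact S.smul_mem _ (hm 2)
  · exact S.smul_mem _ (hm 3)
  · exact hm 0
  · exact hm 4

/-- The two Cartan elements, six positive and six negative root vectors. -/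
def rootElt (e f h : Fin 2 → L) : Fin 2 ⊕ Fin 6 ⊕ Fin 6 → L :=
  Sum.elim h (Sum.elim (posElt e) (posElt f))

theorem IsG2System.lie_rootElt_mem [CharZero K] (H : IsG2System K e f h) {S : Submodule K L}
    (hh : ∀ i, h i ∈ S) (he : ∀ k, posElt e k ∈ S) (hf : ∀ k, posElt f k ∈ S) (i : Fin 2)
    (k : Fin 2 ⊕ Fin 6 ⊕ Fin 6) : ⁅e i, rootElt e f h k⁆ ∈ S := by
  obtain j | k | k := k
  · change ⁅e i, h j⁆ ∈ S
    rw [← lie_skew, H.h_e]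
    refine neg_mem (S.smul_mem _ ?_)
    fin_cases i
    exacts [he 0, he 1]
  · exact H.lie_posElt_mem he i k
  · exact H.swap.lie_posElt_mem' hf (fun i ↦ neg_mem (hh i)) i k

/-- A Lie algebra generated by the `e i` and `f i` of a system of type `G₂` is spanned by fourteen
elements, because their span is stable under the `e i` and `f i`. -/
theorem IsG2System.span_rootElt [CharZero K] (H : IsG2System K e f h)
    (hgen : ∀ T : LieSubalgebra K L, (∀ i, e i ∈ T) → (∀ i, f i ∈ T) → T = ⊤) :
    Submodule.span K (Set.range (rootElt e f h)) = ⊤ := by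
  set S := Submodule.span K (Set.range (rootElt e f h)) with hS
  have hh (i) : h i ∈ S := Submodule.subset_span ⟨.inl i, rfl⟩
  have he (k) : posElt e k ∈ S := Submodule.subset_span ⟨.inr (.inl k), rfl⟩
  have hf (k) : posElt f k ∈ S := Submodule.subset_span ⟨.inr (.inr k), rfl⟩
  -- The elements whose adjoint action preserves `S` form a Lie subalgebra.
  let N : LieSubalgebra K L :=
    { carrier := {z | ∀ s ∈ S, ⁅z, s⁆ ∈ S}
      add_mem' := fun hx hy s hs ↦ by rw [add_lie]; exact add_mem (hx s hs) (hy s hs)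
      zero_mem' := fun s _ ↦ by rw [zero_lie]; exact S.zero_mem
      smul_mem' := fun c z hz s hs ↦ by rw [smul_lie]; exact S.smul_mem c (hz s hs)
      lie_mem' := fun {y z} hy hz s hs ↦ by
        rw [lie_lie]; exact sub_mem (hy _ (hz s hs)) (hz _ (hy s hs)) }
  have hN (z : L) (hz : ∀ k, ⁅z, rootElt e f h k⁆ ∈ S) : z ∈ N := by
    have hle : S ≤ S.comap (LieAlgebra.ad K L z : L →ₗ[K] L) :=
      Submodule.span_le.2 (by rintro _ ⟨k, rfl⟩; exact hz k)
    exact fun s hs ↦ hle hs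
  have hNtop : N = ⊤ := by
    refine hgen N (fun i ↦ hN _ (H.lie_rootElt_mem hh he hf i)) fun i ↦ hN _ ?_
    have := H.swap.lie_rootElt_mem (S := S) (fun i ↦ neg_mem (hh i)) hf he i
    rintro (j | k | k)
    · have hj := this (.inl j)
      simp only [rootElt, Sum.elim_inl, Pi.neg_apply, lie_neg, neg_mem_iff] at hj
      exact hj
    · exact this (.inr (.inr k))
    · exact this (.inr (.inl k))
  let T : LieSubalgebra K L :=
    { S with lie_mem' := fun {y z} _ hz ↦ (hNtop ▸ LieSubalgebra.mem_top y : y ∈ N) z hz }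
  have hT : T = ⊤ := hgen T
    (fun i ↦ by fin_cases i; exacts [he 0, he 1]) (fun i ↦ by fin_cases i; exacts [hf 0, hf 1])
  refine eq_top_iff.2 fun v _ ↦ (hT ▸ LieSubalgebra.mem_top v : v ∈ T)

end

/-! ### The isomorphism with `g₂` -/

section
/-- The Lie algebra `g₂`, written out as a quotient of a free Lie algebra. -/
abbrev SerreG2 (K : Type u) [Field K] : Type u :=
  FreeLieAlgebra K (Generators (Fin 2)) ⧸ Relations.toIdeal K G₂

/-- The Chevalley generators of `g₂`. -/
noncomputable def serreGen (K : Type u) [Field K] (t : Generators (Fin 2)) : SerreG2 K :=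
  LieSubmodule.Quotient.mk (FreeLieAlgebra.of K t)

theorem isG2System_serreGen {K : Type u} [Field K] :
    IsG2System K (fun i ↦ serreGen K (.E i)) (fun i ↦ serreGen K (.F i))
    (fun i ↦ serreGen K (.H i)) := by
  have key (r : FreeLieAlgebra K (Generators (Fin 2))) (hr : r ∈ Relations.toSet K G₂) :
      (LieSubmodule.Quotient.mk r : SerreG2 K) = 0 :=
    LieSubmodule.Quotient.mk_eq_zero'.2 (LieSubmodule.subset_lieSpan hr)
  have HH (i j) := key (Relations.HH K (i, j)) (by simp [Relations.toSet])
  have EF (i j) := key (Relations.EF K (i, j)) (by simp [Relations.toSet])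
  have HE (i j) := key (Relations.HE K G₂ (i, j)) (by simp [Relations.toSet])
  have HF (i j) := key (Relations.HF K G₂ (i, j)) (by simp [Relations.toSet])
  have adE (i j) := key (Relations.adE K G₂ (i, j)) (by simp [Relations.toSet])
  have adF (i j) := key (Relations.adF K G₂ (i, j)) (by simp [Relations.toSet])
  have e3 : (-G₂ 0 1).toNat = 3 := by decide
  have e1 : (-G₂ 1 0).toNat = 1 := by decide
  refine ⟨HH 0 1, ?_, ?_, ?_, ?_, ?_, ?_, ?_⟩
  · intro i j
    have hij := EF i j
    by_cases h : i = j
    · subst h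
      exact sub_eq_zero.1 (by simpa [serreGen, Relations.EF] using hij)
    · simpa [serreGen, Relations.EF, h] using hij
  · intro i j
    rw [← sub_eq_zero, Int.cast_smul_eq_zsmul]
    exact HE i j
  · intro i j
    rw [← sub_eq_zero, Int.cast_smul_eq_zsmul, sub_neg_eq_add]
    exact HF i j
  · have := adE 0 1
    simpa [serreGen, Relations.adE, e3, pow_succ] using this
  · have := adE 1 0
    simpa [serreGen, Relations.adE, e1] using this
  · have := adF 0 1
    simpa [serreGen, Relations.adF, e3, pow_succ] using this
  · have := adF 1 0
    simpa [serreGen, Relations.adF, e1] using this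

theorem exists_serreG2_hom {K : Type u} [Field K] {L : Type*} [LieRing L] [LieAlgebra K L]
    {e f h : Fin 2 → L} (H : IsG2System K e f h) : ∃ F : SerreG2 K →ₗ⁅K⁆ L,
      (∀ i, F (serreGen K (.E i)) = e i) ∧ (∀ i, F (serreGen K (.F i)) = f i) := by
  let g : Generators (Fin 2) → L
    | .H i => h i
    | .E i => e i
    | .F i => f i
  have e3 : (-G₂ 0 1).toNat = 3 := by decide
  have e1 : (-G₂ 1 0).toNat = 1 := by decide
  obtain ⟨F, hF⟩ := exists_lieHom_mk_of_eq (I := Relations.toIdeal K G₂) g (by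
    rw [Relations.toIdeal, LieSubmodule.lieSpan_le]
    rintro _ (((((⟨⟨i, j⟩, rfl⟩ | ⟨⟨i, j⟩, rfl⟩) | ⟨⟨i, j⟩, rfl⟩) | ⟨⟨i, j⟩, rfl⟩) |
      ⟨⟨i, j⟩, rfl⟩) | ⟨⟨i, j⟩, rfl⟩)
    · have : ⁅h 1, h 0⁆ = 0 := by rw [← lie_skew, H.h_h, neg_zero]
      fin_cases i <;> fin_cases j <;> simp [Relations.HH, g, H.h_h, this]
    · by_cases hij : i = j
      · subst hij; simp [Relations.EF, g, H.e_f]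
      · simp [Relations.EF, g, H.e_f, hij]
    · simp [Relations.HE, g, H.h_e, Int.cast_smul_eq_zsmul]
    · simp [Relations.HF, g, H.h_f, Int.cast_smul_eq_zsmul]
    · fin_cases i <;> fin_cases j <;> simp [Relations.adE, e3, e1, pow_succ, g, H.e_e, H.e_e']
    · fin_cases i <;> fin_cases j <;> simp [Relations.adF, e3, e1, pow_succ, g, H.f_f, H.f_f'])
  exact ⟨F, fun i ↦ hF (.E i), fun i ↦ hF (.F i)⟩

variable {K : Type u} [Field K] [CharZero K]

theorem span_serreG2 : ∃ w : Fin 2 ⊕ Fin 6 ⊕ Fin 6 → SerreG2 K,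
    Submodule.span K (Set.range w) = ⊤ := by
  refine ⟨_, isG2System_serreGen.span_rootElt fun T he hf ↦ eq_top_of_mk_of_mem T ?_⟩
  rintro (i | i | i)
  · change serreGen K (.H i) ∈ T
    have : ⁅serreGen K (.E i), serreGen K (.F i)⁆ = serreGen K (.H i) := by
      simpa using isG2System_serreGen.e_f i i
    exact this ▸ T.lie_mem (he i) (hf i)
  · exact he i
  · exact hf i

section
variable {L : Type*} [LieRing L] [LieAlgebra K L] {x : Fin 3 → L}

/-- Chevalley generators inside a Lie algebra with quadruple generators: the short simple root is
the weight of `y 2`, the long one is the root of `e_{12}` (indices from `1` to `3`). -/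
theorem IsQuadTriple.isG2System (hx : IsQuadTriple x) :
    IsG2System K ![dual K x 1, (3⁻¹ : K) • mixed K x 0 1] ![-x 1, (3⁻¹ : K) • mixed K x 1 0]
      ![mixed K x 1 1, (3⁻¹ : K) • (mixed K x 0 0 - mixed K x 1 1)] := by
  have hb (i j : Fin 3) : ⁅dual K x i, x j⁆ = -mixed K x i j := by rw [← lie_skew, mixed]
  have hs (i j k : Fin 3) : ⁅dual K x k, mixed K x i j⁆ =
      (if i = j then (1 : K) else 0) • dual K x k -
        (if j = k then (3 : K) else 0) • dual K x i := by
    rw [← lie_skew, mixed_lie_dual hx]; module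
  have h0 := lie_succ K x 0
  have h0' := dual_lie_dual (K := K) hx 0
  simp only [Fin.isValue, Fin.reduceAdd] at h0 h0'
  have e {u v w : L} (h : ⁅u, v⁆ = (2 : K) • w) : ⁅v, u⁆ = (-2 : K) • w := by
    rw [← lie_skew, h, neg_smul]
  refine ⟨?_, fun i j ↦ ?_, fun i j ↦ ?_, fun i j ↦ ?_, ?_, ?_, ?_, ?_⟩
  · simp [mixed_lie_mixed hx]
  · fin_cases i <;> fin_cases j <;>
      simp [hb, hs, mixed_lie hx, mixed_lie_mixed hx] <;> module
  · fin_cases i <;> fin_cases j <;>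
      simp [G₂, mixed_lie_dual hx, mixed_lie_mixed hx] <;> module
  · fin_cases i <;> fin_cases j <;>
      simp [G₂, mixed_lie hx, mixed_lie_mixed hx] <;> module
  · simp [hs, e h0', hb]
  · simp [mixed_lie_dual hx]
  · simp [hb, lie_mixed hx, e h0]
  · simp [mixed_lie hx]

/-- The Chevalley generators generate the elements `x i`. -/
theorem IsQuadTriple.x_mem (hx : IsQuadTriple x) (T : LieSubalgebra K L) (hy : dual K x 1 ∈ T)
    (hx1 : x 1 ∈ T) (h01 : mixed K x 0 1 ∈ T) (h10 : mixed K x 1 0 ∈ T) (i : Fin 3) : x i ∈ T := by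
  have h0 := T.lie_mem h10 hx1
  have hy0 := T.lie_mem h01 hy
  rw [mixed_lie hx] at h0
  rw [mixed_lie_dual hx] at hy0
  simp only [Fin.isValue, zero_ne_one, one_ne_zero, if_false, if_true, zero_smul, zero_sub,
    sub_zero, neg_mem_iff] at h0 hy0
  replace h0 := (T.toSubmodule.smul_mem_iff (three_ne_zero (α := K))).1 h0
  replace hy0 := (T.toSubmodule.smul_mem_iff (three_ne_zero (α := K))).1 hy0
  have h2 := T.lie_mem hy0 hy
  rw [show (1 : Fin 3) = 0 + 1 from rfl, dual_lie_dual hx] at h2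
  replace h2 := (T.toSubmodule.smul_mem_iff (two_ne_zero (α := K))).1 h2
  fin_cases i
  exacts [h0, hx1, h2]

end

/-- The map from `g₂` is onto by generation, and one-to-one by comparing dimensions. -/
theorem nonempty_quadAlg_equiv_g₂ : Nonempty (QuadAlg K ≃ₗ⁅K⁆ LieAlgebra.g₂ K) := by
  have hq := x_isQuadTriple K
  obtain ⟨F, hE, hF⟩ := exists_serreG2_hom (K := K) hq.isG2System
  have hsurj : Function.Surjective F := by
    rw [← LieHom.range_eq_top]
    refine eq_top_of_mk_of_mem _ (hq.x_mem _ ⟨_, hE 0⟩ ?_ ?_ ?_)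
    · exact neg_mem_iff.1 (⟨_, hF 0⟩ : -x K 1 ∈ F.range)
    · exact (F.range.toSubmodule.smul_mem_iff (inv_ne_zero three_ne_zero)).1
        (⟨_, hE 1⟩ : (3⁻¹ : K) • mixed K (x K) 0 1 ∈ F.range)
    · exact (F.range.toSubmodule.smul_mem_iff (inv_ne_zero three_ne_zero)).1
        (⟨_, hF 1⟩ : (3⁻¹ : K) • mixed K (x K) 1 0 ∈ F.range)
  obtain ⟨w, hw⟩ := span_serreG2 (K := K)
  have : Module.Finite K (SerreG2 K) := ⟨hw ▸ Submodule.fg_span (Set.finite_range w)⟩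
  have hle : Module.finrank K (SerreG2 K) ≤ 14 := by
    have := finrank_range_le_card (R := K) w
    rwa [Set.finrank, hw, finrank_top] at this
  have hge := LinearMap.finrank_le_finrank_of_surjective
    (f := (F : SerreG2 K →ₗ[K] QuadAlg K)) hsurj
  rw [finrank_quadAlg] at hge
  have : Module.Finite K (QuadAlg K) := Module.Finite.of_basis (eltBasis K)
  have hinj : Function.Injective (F : SerreG2 K →ₗ[K] QuadAlg K) :=
    (LinearMap.injective_iff_surjective_of_finrank_eq_finrank
      ((le_antisymm hle hge).trans finrank_quadAlg.symm)).2 hsurj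
  exact ⟨(LieEquiv.ofBijective F ⟨hinj, hsurj⟩).symm⟩

end

end G2Quadruple

open G2Quadruple in
theorem mainTheorem1 (K : Type*) [Field K] [CharZero K] :
    Nonempty (QuadAlg K ≃ₗ⁅K⁆ LieAlgebra.g₂ K) ∧
    Module.finrank K (QuadAlg K) = 14 ∧
    LieAlgebra.IsSimple K (QuadAlg K) ∧
    (∃ b : Module.Basis (Fin 14) K (QuadAlg K), ∀ p, b p = elt K p) ∧
    (∀ p q : Fin 14, p ≤ q → ⁅elt K p, elt K q⁆ = bracketTable (elt K) p q) ∧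
    (∃ φ : LieAlgebra.SpecialLinear.sl (Fin 3) K →ₗ⁅K⁆ QuadAlg K,
      Function.Injective φ ∧
      (∀ A : LieAlgebra.SpecialLinear.sl (Fin 3) K,
        φ A = A.1 0 0 • h₁ K - A.1 2 2 • h₂ K +
          ∑ i : Fin 3, ∑ j : Fin 3, if i = j then 0 else A.1 i j • a K i j) ∧
      (∀ (A : LieAlgebra.SpecialLinear.sl (Fin 3) K) (k : Fin 3),
        ⁅φ A, x K k⁆ = -∑ j : Fin 3, A.1 k j • x K j) ∧
      (∀ (A : LieAlgebra.SpecialLinear.sl (Fin 3) K) (k : Fin 3),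
        ⁅φ A, y K k⁆ = ∑ i : Fin 3, A.1 i k • y K i)) := by
  exact ⟨nonempty_quadAlg_equiv_g₂, finrank_quadAlg, isSimple_quadAlg,
    ⟨eltBasis K, eltBasis_apply⟩, lie_elt,
    ⟨slHom K, slHom_injective, slHom_eq, slHom_lie_x, slHom_lie_y⟩⟩
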